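/- Let $M$ be an oriented matroid of rank $r$ on a finite set $E$, let $f\neq g$ be two elements not in $E$, and let $\overline M$ be a generic extension-lifting of $M$ with respect to $(f,g)$. That is, $\overline M$ is an oriented matroid on $E\cup\{f,g\}$ with $\overline M/g\backslash f=M$ such that - the (unsigned) circuits of $\overline M$ containing $f$ are exactly the sets $B'\cup\{f\}$, where $B'$ is a basis of $\overline M\backslash f$, and - the (unsigned) cocircuits of $\overline M$ containing $g$ are exactly the sets $((E\cup\{f\})\setminus B')\cup\{g\}$, where $B'$ is a basis of $\overline M/g$. Call a signed pseudosphere arrangement an arrangement of $\overline M$ if it is essential and the position vectors of its points, together with the zero vector, are the covectors of $\overline M$. Its vertices are its $0$-dimensional faces; they correspond to the signed cocircuits of $\overline M$. For a basis $B'$ of $\overline M$, denote by $C^*(B';b)$ ($b\in B'$) the signed cocircuit whose support is the complement of the closure of $B'\setminus\{b\}$, with positive sign on $b$, and by $C(B';e)$ ($e\notin B'$) the signed circuit whose support is contained in $B'\cup\{e\}$, with positive sign on $e$. Then: 1. In any arrangement of $\overline M$, every vertex not in $g$ and not in $f$ belongs to exactly $r$ elements, these form a basis of $M$, and their intersection consists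 of this vertex and the opposite vertex. In terms of cocircuits: for every signed cocircuit of $\overline M$ whose support contains $f$ and $g$, the complement of the support in $E\cup\{f,g\}$ has exactly $r$ elements and is a basis of $M$. 2. The map $B\mapsto (E\setminus B)\cup\{f,g\}$ is a bijection from the bases of $M$ to the cocircuits of $\overline M$ containing $f$ and $g$. In any arrangement of $\overline M$, mapping a vertex to its position vector is a bijection from the vertices not in $f$ and not in $g$ to the signed cocircuits of $\overline M$ whose support contains $f$ and $g$. 3. The map $B\mapsto B\cup\{g\}$ is a bijection from the bases of $M$ to the bases of $\overline M$ containing $g$ and not containing $f$. For every basis $B$ of $M$, the support of $C^*(B\cup\{g\};g)$ is $(E\setminus B)\cup\{f,g\}$. 4. For every basis $B\cup\{g\}$ of $\overline M$ with $f,g\notin B$: $f$ lies in the support of $C^*(B\cup\{g\};b)$ for every $b\in B$, $g$ lies in the support of $C(B\cup\{g\};e)$ for every $e\in E\setminus B$, and the support of $C(B\cup\{g\};f)$ is $B\cup\{f,g\}$. -/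

import Mathlib

open Set

/-- Orthogonality of sign vectors: either no common element of the supports, or both an element
where the signs agree and an element where they are opposite. -/
def SignOrthogonal {α : Type*} (X Y : α → SignType) : Prop :=
  (∃ e, X e * Y e = 1) ↔ (∃ e, X e * Y e = -1)

/-- An oriented matroid on a finite ground set `E`, given by its covectors: sign vectors on `E`
(extended by `0` outside `E`) satisfying the covector axioms (zero vector, symmetry, composition,
elimination). -/
@[ext]
structure OrientedMatroid (α : Type*) where
  /-- the ground set -/
  E : Set α
  /-- the covectors -/
  covectors : Set (α → SignType)
  ground_finite : E.Finite
  support_subset : ∀ X ∈ covectors, Function.support X ⊆ E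
  zero_mem : (0 : α → SignType) ∈ covectors
  neg_mem : ∀ X ∈ covectors, -X ∈ covectors
  comp_mem : ∀ X ∈ covectors, ∀ Y ∈ covectors,
    (fun e => if X e ≠ 0 then X e else Y e) ∈ covectors
  elimination : ∀ X ∈ covectors, ∀ Y ∈ covectors, ∀ e, X e ≠ 0 → X e = -Y e →
    ∃ Z ∈ covectors, Z e = 0 ∧
      ∀ a, ¬ (X a ≠ 0 ∧ X a = -Y a) → Z a = if X a ≠ 0 then X a else Y a

namespace OrientedMatroid

variable {α : Type*}

/-- The vectors: the sign vectors on the ground set orthogonal to all covectors. -/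
def vectors (M : OrientedMatroid α) : Set (α → SignType) :=
  {V | Function.support V ⊆ M.E ∧ ∀ X ∈ M.covectors, SignOrthogonal V X}

/-- A signed cocircuit: a nonzero covector of minimal support. -/
def IsSignedCocircuit (M : OrientedMatroid α) (X : α → SignType) : Prop :=
  X ∈ M.covectors ∧ X ≠ 0 ∧ ∀ Y ∈ M.covectors, Y ≠ 0 →
    Function.support Y ⊆ Function.support X → Function.support Y = Function.support X

/-- A signed circuit: a nonzero vector of minimal support. -/
def IsSignedCircuit (M : OrientedMatroid α) (X : α → SignType) : Prop :=
  X ∈ M.vectors ∧ X ≠ 0 ∧ ∀ Y ∈ M.vectors, Y ≠ 0 →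
    Function.support Y ⊆ Function.support X → Function.support Y = Function.support X

/-- An (unsigned) cocircuit: the support of a signed cocircuit. -/
def IsCocircuit (M : OrientedMatroid α) (D : Set α) : Prop :=
  ∃ X, M.IsSignedCocircuit X ∧ Function.support X = D

/-- An (unsigned) circuit: the support of a signed circuit. -/
def IsCircuit (M : OrientedMatroid α) (C : Set α) : Prop :=
  ∃ X, M.IsSignedCircuit X ∧ Function.support X = C

/-- `I` is independent if every `e ∈ I` is separated from `I \ {e}` by a covector. -/
def Indep (M : OrientedMatroid α) (I : Set α) : Prop :=
  I ⊆ M.E ∧ ∀ e ∈ I, ∃ X ∈ M.covectors, X e ≠ 0 ∧ ∀ a ∈ I, a ≠ e → X a = 0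

lemma neg_eq_zero_iff (s : SignType) : -s = 0 ↔ s = 0 := by
  revert s; decide

lemma eq_or_eq_neg {s t : SignType} (hs : s ≠ 0) (ht : t ≠ 0) : s = t ∨ s = -t := by
  revert s t; decide

lemma elim_aux (M : OrientedMatroid α) {X Y : α → SignType} (hX : X ∈ M.covectors)
    (hY : Y ∈ M.covectors) {y : α} (hXy : X y ≠ 0) (hYy : Y y ≠ 0) :
    ∃ Z ∈ M.covectors, Z y = 0 ∧ (∀ a, Y a = 0 → Z a = X a) ∧
      (∀ a, X a = 0 → Y a ≠ 0 → Z a ≠ 0) := by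
  have key : ∀ Y ∈ M.covectors, X y = -Y y → ∃ Z ∈ M.covectors, Z y = 0 ∧
      (∀ a, Y a = 0 → Z a = X a) ∧ (∀ a, X a = 0 → Y a ≠ 0 → Z a ≠ 0) := by
    intro Y hY h
    obtain ⟨Z, hZ, h0, hZa⟩ := M.elimination X hX Y hY y hXy h
    refine ⟨Z, hZ, h0, fun a ha => ?_, fun a ha hb => ?_⟩
    · rw [hZa a (by rintro ⟨h1, h2⟩; rw [ha] at h2; exact h1 (by simpa using h2)), ha]
      by_cases hx : X a = 0 <;> simp [hx]
    · rw [hZa a (fun h => h.1 ha), ha]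
      simpa using hb
  rcases eq_or_eq_neg hXy hYy with h | h
  · obtain ⟨Z, hZ, h0, h1, h2⟩ := key (-Y) (M.neg_mem Y hY) (by simp [h])
    exact ⟨Z, hZ, h0, fun a ha => h1 a (by simp [ha]),
      fun a ha hb => h2 a ha (by simpa [neg_eq_zero_iff] using hb)⟩
  · exact key Y hY h

lemma indep_subset (M : OrientedMatroid α) {I J : Set α} (hJ : M.Indep J) (hIJ : I ⊆ J) :
    M.Indep I := by
  refine ⟨hIJ.trans hJ.1, fun e he => ?_⟩
  obtain ⟨X, hX, h1, h2⟩ := hJ.2 e (hIJ he)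
  exact ⟨X, hX, h1, fun a ha => h2 a (hIJ ha)⟩

lemma indep_insert (M : OrientedMatroid α) {I : Set α} (hI : M.Indep I) {y : α}
    {Y : α → SignType} (hY : Y ∈ M.covectors) (hYI : ∀ a ∈ I, Y a = 0) (hYy : Y y ≠ 0) :
    M.Indep (insert y I) := by
  refine ⟨insert_subset (M.support_subset Y hY hYy) hI.1, ?_⟩
  rintro e (rfl | he)
  · refine ⟨Y, hY, hYy, ?_⟩
    rintro a (rfl | ha) hae
    · exact absurd rfl hae
    · exact hYI a ha
  · obtain ⟨X, hX, h1, h2⟩ := hI.2 e he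
    by_cases hXy : X y = 0
    · refine ⟨X, hX, h1, ?_⟩
      rintro a (rfl | ha) hae
      · exact hXy
      · exact h2 a ha hae
    · obtain ⟨Z, hZ, h0, hZ1, -⟩ := M.elim_aux hX hY hXy hYy
      refine ⟨Z, hZ, by rwa [hZ1 e (hYI e he)], ?_⟩
      rintro a (rfl | ha) hae
      · exact h0
      · rw [hZ1 a (hYI a ha)]; exact h2 a ha hae

lemma ncard_le_of_spanned (M : OrientedMatroid α) {I : Set α} (hI : I ⊆ M.E) :
    ∀ (n : ℕ) (J : Set α), (J \ I).ncard = n → M.Indep J →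
      (∀ x ∈ J, ∀ X ∈ M.covectors, (∀ a ∈ I, X a = 0) → X x = 0) → J.ncard ≤ I.ncard := by
  have hIf : I.Finite := M.ground_finite.subset hI
  intro n
  induction n with
  | zero =>
    intro J hn hJ _
    have hJf : J.Finite := M.ground_finite.subset hJ.1
    rw [ncard_eq_zero (hJf.subset sdiff_subset)] at hn
    exact ncard_le_ncard (sdiff_eq_empty.1 hn) hIf
  | succ n ih =>
    intro J hn hJ hspan
    have hJf : J.Finite := M.ground_finite.subset hJ.1
    obtain ⟨x, hxJ, hxI⟩ : (J \ I).Nonempty := by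
      rw [nonempty_iff_ne_empty]; intro h; simp [h] at hn
    obtain ⟨X, hX, hXx, hXJ⟩ := hJ.2 x hxJ
    obtain ⟨y, hyI, hXy⟩ : ∃ y ∈ I, X y ≠ 0 := by
      by_contra! h
      exact hXx (hspan x hxJ X hX h)
    have hyJ : y ∉ J \ {x} := fun h => hXy (hXJ y h.1 h.2)
    have hJ' : M.Indep (insert y (J \ {x})) :=
      M.indep_insert (M.indep_subset hJ sdiff_subset) hX (fun a ha => hXJ a ha.1 ha.2) hXy
    have hcard : (insert y (J \ {x})).ncard = J.ncard := by
      rw [ncard_insert_of_notMem hyJ (hJf.subset sdiff_subset),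
        ncard_sdiff_singleton_add_one hxJ hJf]
    rw [← hcard]
    refine ih _ ?_ hJ' ?_
    · have : insert y (J \ {x}) \ I = (J \ I) \ {x} := by
        ext a; simp only [mem_sdiff, mem_insert_iff, mem_singleton_iff]
        constructor
        · rintro ⟨rfl | h, h2⟩
          · exact absurd hyI h2
          · exact ⟨⟨h.1, h2⟩, h.2⟩
        · rintro ⟨⟨h1, h2⟩, h3⟩; exact ⟨Or.inr ⟨h1, h3⟩, h2⟩
      rw [this]
      have := ncard_sdiff_singleton_add_one (a := x) (s := J \ I) ⟨hxJ, hxI⟩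
        (hJf.subset sdiff_subset)
      omega
    · rintro a (rfl | ha) W hW hWI
      · exact hWI _ hyI
      · exact hspan a ha.1 W hW hWI

/-- The underlying matroid. -/
def toMatroid (M : OrientedMatroid α) : Matroid α :=
  (IndepMatroid.ofFinite M.ground_finite M.Indep
    ⟨empty_subset _, fun e he => absurd he (notMem_empty e)⟩
    (fun _ _ hJ hIJ => M.indep_subset hJ hIJ)
    (by
      intro I J hI hJ hlt
      by_contra! hcon
      refine absurd (M.ncard_le_of_spanned hI.1 _ J rfl hJ ?_) (not_le.2 hlt)
      intro x hx X hX hXI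
      by_contra hXx
      exact hcon x hx (fun hxI => hXx (hXI x hxI)) (M.indep_insert hI hX hXI hXx))
    (fun _ hI => hI.1)).matroid

@[simp] lemma toMatroid_E (M : OrientedMatroid α) : M.toMatroid.E = M.E := rfl

@[simp] lemma toMatroid_indep (M : OrientedMatroid α) (I : Set α) :
    M.toMatroid.Indep I ↔ M.Indep I := Iff.rfl

/-- A basis: a basis of the underlying matroid. -/
def IsBase (M : OrientedMatroid α) (B : Set α) : Prop := M.toMatroid.IsBase B

/-- The rank of the underlying matroid. -/
noncomputable def rank (M : OrientedMatroid α) : ℕ∞ := M.toMatroid.eRank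

/-- `D` is the fundamental cocircuit `C*(B;b)`: the signed cocircuit whose support is the
complement of the closure of `B \ b`, positive on `b`. -/
def IsFundCocircuit (M : OrientedMatroid α) (B : Set α) (b : α) (D : α → SignType) : Prop :=
  M.IsSignedCocircuit D ∧ Function.support D = M.E \ M.toMatroid.closure (B \ {b}) ∧ D b = 1

/-- `C` is the fundamental circuit `C(B;e)`: the signed circuit whose support is contained
in `B ∪ e`, positive on `e`. -/
def IsFundCircuit (M : OrientedMatroid α) (B : Set α) (e : α) (C : α → SignType) : Prop :=
  M.IsSignedCircuit C ∧ Function.support C ⊆ insert e B ∧ C e = 1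

lemma mem_closure_iff_of_indep (M : OrientedMatroid α) {I : Set α} (hI : M.Indep I) (e : α) :
    e ∈ M.toMatroid.closure I ↔
      e ∈ M.E ∧ ∀ X ∈ M.covectors, (∀ a ∈ I, X a = 0) → X e = 0 := by
  have hI' : M.toMatroid.Indep I := hI
  rw [hI'.mem_closure_iff']
  simp only [toMatroid_E, toMatroid_indep]
  refine and_congr_right fun he => ⟨fun h X hX hXI => ?_, fun h hins => ?_⟩
  · by_contra hXe
    exact hXe (hXI e (h (M.indep_insert hI hX hXI hXe)))
  · by_contra heI
    obtain ⟨X, hX, h1, h2⟩ := hins.2 e (mem_insert _ _)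
    exact h1 (h X hX fun a ha => h2 a (mem_insert_of_mem _ ha) (by rintro rfl; exact heI ha))

lemma eq_zero_of_base (M : OrientedMatroid α) {B : Set α} (hB : M.IsBase B) {X : α → SignType}
    (hX : X ∈ M.covectors) (h : ∀ a ∈ B, X a = 0) : X = 0 := by
  have hB' : M.toMatroid.IsBase B := hB
  funext e
  by_contra he
  have heE : e ∈ M.toMatroid.closure B := by
    rw [hB'.closure_eq]; exact M.support_subset X hX he
  exact he (((M.mem_closure_iff_of_indep hB'.indep e).1 heE).2 X hX h)

lemma exists_covector_of_base (M : OrientedMatroid α) {B : Set α} (hB : M.IsBase B) {b : α}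
    (hb : b ∈ B) : ∃ Y ∈ M.covectors, Y b = 1 ∧ ∀ a ∈ B, a ≠ b → Y a = 0 := by
  have hB' : M.Indep B := Matroid.IsBase.indep hB
  obtain ⟨X, hX, h1, h2⟩ := hB'.2 b hb
  rcases SignType.trichotomy (X b) with h | h | h
  · exact ⟨-X, M.neg_mem X hX, by simp [h], fun a ha hab => by simp [h2 a ha hab]⟩
  · exact absurd h h1
  · exact ⟨X, hX, h, h2⟩

lemma support_eq_of_covector (M : OrientedMatroid α) {B : Set α} (hB : M.IsBase B) {b : α}
    {Y : α → SignType} (hY : Y ∈ M.covectors) (hYb : Y b ≠ 0)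
    (h : ∀ a ∈ B, a ≠ b → Y a = 0) :
    Function.support Y = M.E \ M.toMatroid.closure (B \ {b}) := by
  have hB' : M.Indep B := Matroid.IsBase.indep hB
  ext e
  rw [mem_sdiff, M.mem_closure_iff_of_indep (M.indep_subset hB' sdiff_subset)]
  constructor
  · exact fun he => ⟨M.support_subset Y hY he,
      fun hc => he (hc.2 Y hY fun a ha => h a ha.1 ha.2)⟩
  · rintro ⟨heE, hc⟩ he
    push Not at hc
    obtain ⟨X, hX, hXB, hXe⟩ := hc heE
    by_cases hXb : X b = 0
    · refine hXe (congrFun (M.eq_zero_of_base hB hX fun a ha => ?_) e)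
      by_cases hab : a = b
      · rw [hab, hXb]
      · exact hXB a ⟨ha, hab⟩
    · obtain ⟨Z, hZ, h0, hZ1, -⟩ := M.elim_aux hX hY hXb hYb
      have : Z = 0 := M.eq_zero_of_base hB hZ fun a ha => by
        by_cases hab : a = b
        · rw [hab, h0]
        · rw [hZ1 a (h a ha hab)]; exact hXB a ⟨ha, hab⟩
      exact hXe (by rw [← hZ1 e he, this]; rfl)

/-- The fundamental cocircuit exists and is unique. -/
theorem existsUnique_fundCocircuit (M : OrientedMatroid α) {B : Set α} (hB : M.IsBase B) {b : α}
    (hb : b ∈ B) : ∃! D, M.IsFundCocircuit B b D := by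
  have hB' : M.Indep B := Matroid.IsBase.indep hB
  obtain ⟨Y, hY, hYb, hYB⟩ := M.exists_covector_of_base hB hb
  have hYb0 : Y b ≠ 0 := by rw [hYb]; decide
  have hsupp := M.support_eq_of_covector hB hY hYb0 hYB
  refine ⟨Y, ⟨⟨hY, fun h => hYb0 (congrFun h b), fun Z hZ hZ0 hZY => ?_⟩, hsupp, hYb⟩, ?_⟩
  · have hZB : ∀ a ∈ B, a ≠ b → Z a = 0 := fun a ha hab => by
      by_contra hZa
      exact hZY hZa (hYB a ha hab)
    rw [hsupp]
    refine M.support_eq_of_covector hB hZ (fun hZb => hZ0 ?_) hZB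
    refine M.eq_zero_of_base hB hZ fun a ha => ?_
    by_cases hab : a = b
    · rw [hab, hZb]
    · exact hZB a ha hab
  · rintro D ⟨⟨hD, -, -⟩, hDs, hDb⟩
    have hDB : ∀ a ∈ B, a ≠ b → D a = 0 := fun a ha hab => by
      by_contra hDa
      have : a ∈ Function.support Y := by rw [hsupp, ← hDs]; exact hDa
      exact this (hYB a ha hab)
    funext e
    by_cases hYe : Y e = 0
    · by_contra hDe
      have : e ∈ Function.support Y := by
        rw [hsupp, ← hDs]; exact fun h => hDe (by rw [hYe, h])
      exact this hYe
    · have hDe : D e ≠ 0 := by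
        have : e ∈ Function.support D := by rw [hDs, ← hsupp]; exact hYe
        exact this
      rcases eq_or_eq_neg hDe hYe with h | h
      · exact h
      · exfalso
        obtain ⟨Z, hZ, h0, hZa⟩ := M.elimination D hD Y hY e hDe h
        have hZb : Z b = 1 := by
          rw [hZa b (by rw [hDb, hYb]; decide), hDb]; simp
        have hZs := M.support_eq_of_covector hB hZ (by rw [hZb]; decide) fun a ha hab => by
          rw [hZa a (fun h => h.1 (hDB a ha hab)), hDB a ha hab, hYB a ha hab]; simp
        have : e ∈ Function.support Z := by rw [hZs, ← hsupp]; exact hYe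
        exact this h0

lemma orthogonal_aux {V Y : α → SignType} (h : SignOrthogonal V Y) {b e : α}
    (hs : ∀ a, a ≠ b → a ≠ e → V a * Y a = 0) : V b * Y b = -(V e * Y e) := by
  have h1 : ∀ s : SignType, s ≠ 0 → ((∃ a, V a * Y a = s) ↔ (V b * Y b = s ∨ V e * Y e = s)) := by
    intro s hs0
    constructor
    · rintro ⟨a, ha⟩
      by_cases hab : a = b
      · left; rw [← hab, ha]
      · by_cases hae : a = e
        · right; rw [← hae, ha]
        · exact absurd (ha.symm.trans (hs a hab hae)) hs0
    · rintro (h | h)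
      exacts [⟨b, h⟩, ⟨e, h⟩]
  rw [SignOrthogonal, h1 1 (by decide), h1 (-1) (by decide)] at h
  revert h
  generalize V b * Y b = s
  generalize V e * Y e = t
  revert s t
  decide

/-- The fundamental circuit exists and is unique. -/
theorem existsUnique_fundCircuit (M : OrientedMatroid α) {B : Set α} (hB : M.IsBase B) {e : α}
    (he : e ∈ M.E) (heB : e ∉ B) : ∃! C, M.IsFundCircuit B e C := by
  classical
  have hBE : B ⊆ M.E := Matroid.IsBase.subset_ground hB
  have hBf : B.Finite := M.ground_finite.subset hBE
  choose! Y hY hYb hYB using fun b (hb : b ∈ B) => M.exists_covector_of_base hB hb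
  have hne : ∀ b ∈ B, b ≠ e := fun b hb h => heB (h ▸ hb)
  -- any vector supported in `B ∪ e` is determined by its value at `e`
  have hdet : ∀ D ∈ M.vectors, Function.support D ⊆ insert e B →
      ∀ b ∈ B, D b = -(D e * Y b e) := by
    intro D hD hDs b hb
    have := orthogonal_aux (hD.2 (Y b) (hY b hb)) (b := b) (e := e) (fun a hab hae => ?_)
    · rwa [hYb b hb, mul_one] at this
    · by_cases hDa : D a = 0
      · rw [hDa, zero_mul]
      · rw [hYB b hb a ((hDs hDa).resolve_left hae) hab, mul_zero]
  let C : α → SignType := fun a => if a = e then 1 else if a ∈ B then -(Y a e) else 0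
  have hCe : C e = 1 := by simp [C]
  have hCb : ∀ b ∈ B, C b = -(Y b e) := fun b hb => by simp [C, hne b hb, hb]
  have hCs : Function.support C ⊆ insert e B := by
    intro a ha
    by_contra h
    rw [mem_insert_iff, not_or] at h
    exact ha (by simp [C, h.1, h.2])
  -- no covector is nonzero and sign-compatible with `C` on its support
  have hconf : ∀ (n : ℕ) (X : α → SignType), X ∈ M.covectors →
      (B ∩ Function.support X).ncard = n → (∀ a, C a * X a ≠ -1) → ∀ a, C a * X a ≠ 1 := by
    intro n
    induction n with
    | zero =>
      intro X hX hn _ a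
      rw [ncard_eq_zero (hBf.subset inter_subset_left)] at hn
      have : X = 0 := M.eq_zero_of_base hB hX fun a ha => by
        by_contra h
        exact notMem_empty a (hn ▸ ⟨ha, h⟩)
      simp [this]
    | succ n ih =>
      intro X hX hn hneg
      obtain ⟨b, hb, hXb⟩ : (B ∩ Function.support X).Nonempty := by
        rw [nonempty_iff_ne_empty]; intro h; simp [h] at hn
      have hXb : X b ≠ 0 := hXb
      have hW : ∃ W ∈ M.covectors, W b = -X b ∧ W e = -(X b * Y b e) ∧
          ∀ a ∈ B, a ≠ b → W a = 0 := by
        rcases SignType.trichotomy (X b) with h | h | h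
        · exact ⟨Y b, hY b hb, by simp [h, hYb b hb], by simp [h], hYB b hb⟩
        · exact absurd h hXb
        · exact ⟨-Y b, M.neg_mem _ (hY b hb), by simp [h, hYb b hb], by simp [h],
            fun a ha hab => by simp [hYB b hb a ha hab]⟩
      obtain ⟨W, hWm, hWb, hWe, hWB⟩ := hW
      obtain ⟨Z, hZ, h0, hZa⟩ := M.elimination X hX W hWm b hXb (by simp [hWb])
      have hZB : ∀ a ∈ B, a ≠ b → Z a = X a := fun a ha hab => by
        rw [hZa a (by rw [hWB a ha hab]; intro h; exact h.1 (by simpa using h.2)), hWB a ha hab]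
        by_cases hx : X a = 0 <;> simp [hx]
      have hbneg := hneg b
      have heneg := hneg e
      rw [hCb b hb] at hbneg
      rw [hCe, one_mul] at heneg
      have hWe0 : W e = 0 ∨ W e = 1 := by
        rw [hWe]; revert hbneg; generalize X b = s; generalize Y b e = t; revert s t; decide
      have hZe : Z e = if X e ≠ 0 then X e else W e := by
        refine hZa e ?_
        rintro ⟨h1, h2⟩
        rcases hWe0 with h | h
        · rw [h] at h2; exact h1 (by simpa using h2)
        · rw [h] at h2; exact heneg h2
      have hZcard : (B ∩ Function.support Z).ncard = n := by
        have : B ∩ Function.support Z = (B ∩ Function.support X) \ {b} := by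
          ext a
          simp only [mem_inter_iff, Function.mem_support, mem_sdiff, mem_singleton_iff]
          by_cases hab : a = b
          · simp [hab, h0]
          · constructor
            · rintro ⟨h1, h2⟩; exact ⟨⟨h1, by rwa [← hZB a h1 hab]⟩, hab⟩
            · rintro ⟨⟨h1, h2⟩, -⟩; exact ⟨h1, by rwa [hZB a h1 hab]⟩
        rw [this]
        have := ncard_sdiff_singleton_add_one (a := b) (s := B ∩ Function.support X) ⟨hb, hXb⟩
          (hBf.subset inter_subset_left)
        omega
      have hZe1 : Z e ≠ -1 := by
        rw [hZe]; split_ifs with h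
        · exact heneg
        · rcases hWe0 with h | h <;> rw [h] <;> decide
      have hZ1 := ih Z hZ hZcard (fun a => by
        by_cases hae : a = e
        · rw [hae, hCe, one_mul]; exact hZe1
        · by_cases haB : a ∈ B
          · by_cases hab : a = b
            · rw [hab, h0, mul_zero]; decide
            · rw [hZB a haB hab]; exact hneg a
          · have : C a = 0 := by simp [C, hae, haB]
            rw [this, zero_mul]; decide)
      intro a ha
      by_cases hab : a = b
      · subst hab
        have hZe2 := hZ1 e
        rw [hCe, one_mul, hZe] at hZe2
        rw [hCb a hb] at ha
        have hw : W e = 1 := by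
          rw [hWe]; revert ha; generalize X a = s; generalize Y a e = t; revert s t; decide
        rw [hw] at hZe2
        revert hZe2 heneg
        generalize X e = s
        revert s; decide
      · by_cases hae : a = e
        · subst hae
          rw [hCe, one_mul] at ha
          refine hZ1 a ?_
          rw [hCe, one_mul, hZe, if_pos (by rw [ha]; decide), ha]
        · by_cases haB : a ∈ B
          · exact hZ1 a (by rw [hZB a haB hab]; exact ha)
          · have : C a = 0 := by simp [C, hae, haB]
            rw [this, zero_mul] at ha
            exact absurd ha (by decide)
  have hCv : C ∈ M.vectors := by
    refine ⟨hCs.trans (insert_subset he hBE), fun X hX => ?_⟩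
    have hn : ∀ a (s : SignType), C a * (-X) a = -s ↔ C a * X a = s := by
      intro a s; simp [mul_neg]
    constructor
    · rintro ⟨a, ha⟩
      by_contra! h
      exact hconf _ X hX rfl h a ha
    · rintro ⟨a, ha⟩
      by_contra! h
      refine hconf _ (-X) (M.neg_mem X hX) rfl (fun c hc => h c ((hn c 1).1 hc)) a ?_
      have := (hn a (-1)).2 ha
      simpa using this
  refine ⟨C, ⟨⟨hCv, fun h => absurd ((congrFun h e).symm.trans hCe) (by simp),
    fun D hD hD0 hDC => ?_⟩, hCs, hCe⟩, ?_⟩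
  · have hd := hdet D hD (hDC.trans hCs)
    have hDe : D e ≠ 0 := by
      intro hDe
      refine hD0 (funext fun a => ?_)
      by_contra ha
      rcases hCs (hDC ha) with rfl | haB
      · exact ha hDe
      · exact ha (by rw [hd a haB, hDe, zero_mul]; rfl)
    refine hDC.antisymm fun a ha => ?_
    rcases hCs ha with rfl | haB
    · exact hDe
    · have hYe : Y a e ≠ 0 := by
        intro h
        have : C a = 0 := by rw [hCb a haB, h]; rfl
        exact ha this
      have : D a ≠ 0 := by
        rw [hd a haB, Ne, neg_eq_zero_iff]
        exact mul_ne_zero hDe hYe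
      exact this
  · rintro D ⟨⟨hD, -, -⟩, hDs, hDe⟩
    funext a
    by_cases hae : a = e
    · rw [hae, hDe, hCe]
    · by_cases haB : a ∈ B
      · rw [hdet D hD hDs a haB, hDe, one_mul, hCb a haB]
      · have h1 : C a = 0 := by simp [C, hae, haB]
        rw [h1]
        by_contra h
        rcases hDs h with h | h
        exacts [hae h, haB h]

lemma dep_of_vector (M : OrientedMatroid α) {X : α → SignType} (hX : X ∈ M.vectors)
    (hX0 : X ≠ 0) : M.toMatroid.Dep (Function.support X) := by
  refine ⟨fun hi => ?_, hX.1⟩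
  obtain ⟨e, he⟩ := Function.ne_iff.1 hX0
  obtain ⟨Y, hY, h1, h2⟩ := hi.2 e he
  have h := orthogonal_aux (hX.2 Y hY) (b := e) (e := e) (fun a hae _ => by
    by_cases hXa : X a = 0
    · rw [hXa, zero_mul]
    · rw [h2 a hXa hae, mul_zero])
  have hne : X e * Y e ≠ 0 := mul_ne_zero he h1
  revert h hne
  generalize X e * Y e = s
  revert s
  decide

/-- The circuits are the circuits of the underlying matroid. -/
theorem isCircuit_iff (M : OrientedMatroid α) (C : Set α) :
    M.IsCircuit C ↔ M.toMatroid.IsCircuit C := by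
  have key : ∀ C, M.toMatroid.IsCircuit C → M.IsCircuit C := by
    intro C hC
    obtain ⟨e, he⟩ := hC.nonempty
    obtain ⟨B, hB, hCB⟩ := (hC.sdiff_singleton_indep he).exists_isBase_superset
    have heB : e ∉ B := fun h => hC.not_indep (hB.indep.subset fun a ha => by
      by_cases hae : a = e
      · rwa [hae]
      · exact hCB ⟨ha, hae⟩)
    obtain ⟨X, ⟨hX, hXs, hXe⟩, -⟩ :=
      M.existsUnique_fundCircuit (B := B) hB (hC.subset_ground he) heB
    refine ⟨X, hX, ?_⟩
    have hdep := M.dep_of_vector hX.1 hX.2.1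
    obtain ⟨C', hC's, hC'⟩ := hdep.exists_isCircuit_subset
    have hCfund := hC.eq_fundCircuit_of_subset hB.indep (e := e) (fun a ha => by
      by_cases hae : a = e
      · exact Or.inl hae
      · exact Or.inr (hCB ⟨ha, hae⟩))
    have heC' : e ∈ C' := by
      by_contra h
      refine hC'.not_indep (hB.indep.subset fun a ha => ?_)
      exact (hXs (hC's ha)).resolve_left (by rintro rfl; exact h ha)
    have hC'fund := hC'.eq_fundCircuit_of_subset hB.indep (e := e) (hC's.trans hXs)
    -- the support of `X` is contained in the fundamental circuit
    have hCX : C ⊆ Function.support X := by rw [hCfund, ← hC'fund]; exact hC's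
    refine Subset.antisymm (fun a ha => ?_) hCX
    by_contra haC
    have haB : a ∈ B := (hXs ha).resolve_left (by rintro rfl; exact haC he)
    obtain ⟨Y, hY, hYa, hYB⟩ := M.exists_covector_of_base hB haB
    have hae : a ≠ e := by rintro rfl; exact haC he
    have hYe : Y e = 0 := by
      have hcl : e ∈ M.toMatroid.closure (C \ {e}) := hC.mem_closure_sdiff_singleton_of_mem he
      rw [M.mem_closure_iff_of_indep (hC.sdiff_singleton_indep he)] at hcl
      refine hcl.2 Y hY fun c hc => hYB c (hCB hc) ?_
      rintro rfl; exact haC hc.1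
    have := orthogonal_aux (hX.1.2 Y hY) (b := a) (e := e) (fun c hca hce => by
      by_cases hXc : X c = 0
      · rw [hXc, zero_mul]
      · rw [hYB c ((hXs hXc).resolve_left hce) hca, mul_zero])
    rw [hYa, mul_one, hYe, mul_zero] at this
    exact ha this
  refine ⟨?_, key C⟩
  rintro ⟨X, hX, rfl⟩
  have hdep := M.dep_of_vector hX.1 hX.2.1
  obtain ⟨C', hC's, hC'⟩ := hdep.exists_isCircuit_subset
  obtain ⟨X', hX', rfl⟩ := key C' hC'
  have := hX.2.2 X' hX'.1 hX'.2.1 hC's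
  rwa [← this]

lemma meets_bases_iff (M : OrientedMatroid α) (D : Set α) :
    (∀ B, M.toMatroid.IsBase B → (D ∩ B).Nonempty) ↔
      ∃ X ∈ M.covectors, X ≠ 0 ∧ Function.support X ⊆ D := by
  constructor
  · intro h
    obtain ⟨I, hI⟩ := M.toMatroid.exists_isBasis (M.E \ D) sdiff_subset
    obtain ⟨B, hB, hIB⟩ := hI.indep.exists_isBase_superset
    obtain ⟨b, hbD, hbB⟩ := h B hB
    obtain ⟨Y, hY, hYb, hYB⟩ := M.exists_covector_of_base hB hbB
    have hbI : b ∉ I := fun hb => (hI.subset hb).2 hbD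
    refine ⟨Y, hY, fun h0 => absurd ((congrFun h0 b).symm.trans hYb) (by simp), fun e he => ?_⟩
    by_contra heD
    have hcl := hI.subset_closure ⟨M.support_subset Y hY he, heD⟩
    rw [M.mem_closure_iff_of_indep hI.indep] at hcl
    exact he (hcl.2 Y hY fun a ha => hYB a (hIB ha) (by rintro rfl; exact hbI ha))
  · rintro ⟨X, hX, hX0, hXD⟩ B hB
    by_contra hne
    refine hX0 (M.eq_zero_of_base hB hX fun a ha => ?_)
    by_contra hXa
    exact hne ⟨a, hXD hXa, ha⟩

/-- The cocircuits are the cocircuits of the underlying matroid. -/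
theorem isCocircuit_iff (M : OrientedMatroid α) (D : Set α) :
    M.IsCocircuit D ↔ M.toMatroid.IsCocircuit D := by
  rw [Matroid.isCocircuit_iff_minimal]
  constructor
  · rintro ⟨X, ⟨hX, hX0, hmin⟩, rfl⟩
    refine ⟨(M.meets_bases_iff _).2 ⟨X, hX, hX0, Subset.rfl⟩, ?_⟩
    intro D' hD' hle
    have hle' : D' ⊆ Function.support X := hle
    obtain ⟨Y, hY, hY0, hYD⟩ :=
      (M.meets_bases_iff _).1 hD'
    have := hmin Y hY hY0 (hYD.trans hle')
    show Function.support X ⊆ D'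
    rw [← this]; exact hYD
  · intro hD
    obtain ⟨X, hX, hX0, hXD⟩ := (M.meets_bases_iff _).1 hD.prop
    have hle : ∀ Y ∈ M.covectors, Y ≠ 0 → Function.support Y ⊆ D → D ⊆ Function.support Y :=
      fun Y hY hY0 hYD => hD.le_of_le
        ((M.meets_bases_iff _).2 ⟨Y, hY, hY0, Subset.rfl⟩) hYD
    have hXeq : Function.support X = D := hXD.antisymm (hle X hX hX0 hXD)
    refine ⟨X, ⟨hX, hX0, fun Y hY hY0 hYX => ?_⟩, hXeq⟩
    exact hYX.antisymm (by rw [hXeq]; exact hle Y hY hY0 (hYX.trans hXD))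

/-- The deletion `M \ e`: covectors are restricted to `E \ e`. -/
def delete (M : OrientedMatroid α) (e : α) : OrientedMatroid α where
  E := M.E \ {e}
  covectors := {X | X e = 0 ∧ ∃ Y ∈ M.covectors, ∀ a, a ≠ e → X a = Y a}
  ground_finite := M.ground_finite.subset sdiff_subset
  support_subset := by
    rintro X ⟨h0, Y, hY, h⟩ a ha
    have hae : a ≠ e := by rintro rfl; exact ha h0
    exact ⟨M.support_subset Y hY (by rw [Function.mem_support, ← h a hae]; exact ha), hae⟩
  zero_mem := ⟨rfl, 0, M.zero_mem, fun _ _ => rfl⟩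
  neg_mem := by
    rintro X ⟨h0, Y, hY, h⟩
    exact ⟨by simp [h0], -Y, M.neg_mem Y hY, fun a ha => by simp [h a ha]⟩
  comp_mem := by
    rintro X ⟨hX0, X', hX', hX⟩ Y ⟨hY0, Y', hY', hY⟩
    exact ⟨by simp [hX0, hY0], _, M.comp_mem X' hX' Y' hY', fun a ha => by
      simp only [hX a ha, hY a ha]⟩
  elimination := by
    classical
    rintro X ⟨hX0, X', hX', hX⟩ Y ⟨hY0, Y', hY', hY⟩ c hc hXY
    have hce : c ≠ e := by rintro rfl; exact hc hX0
    obtain ⟨Z, hZ, hZc, hZa⟩ := M.elimination X' hX' Y' hY' c (by rwa [← hX c hce])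
      (by rwa [← hX c hce, ← hY c hce])
    refine ⟨fun a => if a = e then 0 else Z a, ⟨by simp, Z, hZ, fun a ha => by simp [ha]⟩,
      by simp [hZc], fun a ha => ?_⟩
    by_cases hae : a = e
    · simp [hae, hX0, hY0]
    · simp only [hae, if_false]
      rw [hX a hae, hY a hae] at ha ⊢
      exact hZa a ha

/-- The contraction `M / e`: its covectors are those covectors of `M` that vanish on `e`. -/
def contract (M : OrientedMatroid α) (e : α) : OrientedMatroid α where
  E := M.E \ {e}
  covectors := {X | X ∈ M.covectors ∧ X e = 0}
  ground_finite := M.ground_finite.subset sdiff_subset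
  support_subset := fun X hX a ha =>
    ⟨M.support_subset X hX.1 ha, by rintro rfl; exact ha hX.2⟩
  zero_mem := ⟨M.zero_mem, rfl⟩
  neg_mem := fun X hX => ⟨M.neg_mem X hX.1, by simp [hX.2]⟩
  comp_mem := fun X hX Y hY => ⟨M.comp_mem X hX.1 Y hY.1, by simp [hX.2, hY.2]⟩
  elimination := by
    rintro X ⟨hX, hX0⟩ Y ⟨hY, hY0⟩ c hc hXY
    obtain ⟨Z, hZ, hZc, hZa⟩ := M.elimination X hX Y hY c hc hXY
    exact ⟨Z, ⟨hZ, by rw [hZa e (fun h => h.1 hX0)]; simp [hX0, hY0]⟩, hZc, hZa⟩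

/-- `N` is a generic extension of `M` with respect to `f`: it is an oriented matroid on `E ∪ f`
with `N \ f = M`, and its circuits containing `f` are exactly the sets `B ∪ f` with `B` a basis
of `M`. -/
structure IsGenericExtension (N M : OrientedMatroid α) (f : α) : Prop where
  notMem : f ∉ M.E
  ground : N.E = insert f M.E
  delete_eq : N.delete f = M
  circuits : {C | N.IsCircuit C ∧ f ∈ C} = {C | ∃ B, M.IsBase B ∧ C = insert f B}

/-- `N` is a generic lifting of `M` with respect to `g`: it is an oriented matroid on `E ∪ g`
with `N / g = M`, and its cocircuits containing `g` are exactly the sets `(E \ B) ∪ g` with `B`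
a basis of `M`. -/
structure IsGenericLifting (N M : OrientedMatroid α) (g : α) : Prop where
  notMem : g ∉ M.E
  ground : N.E = insert g M.E
  contract_eq : N.contract g = M
  cocircuits : {D | N.IsCocircuit D ∧ g ∈ D} = {D | ∃ B, M.IsBase B ∧ D = insert g (M.E \ B)}

/-- `N` is a generic extension-lifting of `M` with respect to `(f, g)`: an oriented matroid on
`E ∪ {f, g}` with `N / g \ f = M` that is a generic extension of `N \ f` with respect to `f` and
a generic lifting of `N / g` with respect to `g`. -/
structure IsGenericExtensionLifting (N M : OrientedMatroid α) (f g : α) : Prop where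
  ne : f ≠ g
  notMem_left : f ∉ M.E
  notMem_right : g ∉ M.E
  ground : N.E = M.E ∪ {f, g}
  minor_eq : (N.contract g).delete f = M
  extension : N.IsGenericExtension (N.delete f) f
  lifting : N.IsGenericLifting (N.contract g) g

end OrientedMatroid

/-- The unit sphere of `ℝⁿ`, that is, the sphere `S^(n-1)`; it is empty for `n = 0`. -/
abbrev USphere (n : ℕ) : Type :=
  Metric.sphere (0 : EuclideanSpace ℝ (Fin n)) 1

/-- A signed pseudosphere arrangement in the sphere `S^(n-1)`, indexed by `E`. It is encoded by the
position vectors of the points: the pseudosphere `S_e` and its positive and negative sides are the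
sets of points `p` where `sign p e` is `0`, `1` and `-1`. The case where `S_e` is the whole sphere
(`e` is a loop) is allowed. -/
structure PseudosphereArrangement {α : Type*} (E : Set α) (n : ℕ) where
  /-- the position of a point with respect to the elements -/
  sign : USphere n → α → SignType
  /-- every intersection of pseudospheres is a topological sphere (possibly empty) -/
  inter_sphere : ∀ A ⊆ E, ∃ k : ℕ, Nonempty (USphere k ≃ₜ {p | ∀ a ∈ A, sign p a = 0})
  /-- if `S_e` does not contain the intersection `S_A`, then it cuts `S_A` in a pseudosphere of
  `S_A`, whose sides are cut by the sides of `S_e`: some homeomorphism from a standard sphere to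
  `S_A` maps the equator and the two open hemispheres there -/
  inter_pseudosphere : ∀ A ⊆ E, ∀ e ∈ E, (∃ p, (∀ a ∈ A, sign p a = 0) ∧ sign p e ≠ 0) →
    ∃ (k : ℕ) (h : USphere (k + 1) ≃ₜ {p | ∀ a ∈ A, sign p a = 0}),
      ∀ x : USphere (k + 1), sign (h x).1 e = SignType.sign (x.1 (Fin.last k))
  /-- the arrangement is essential -/
  essential : ∀ p, ∃ e ∈ E, sign p e ≠ 0

namespace PseudosphereArrangement

variable {α : Type*} {E : Set α} {n : ℕ}

/-- The pseudosphere `S_e`. -/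
def pseudosphere (A : PseudosphereArrangement E n) (e : α) : Set (USphere n) :=
  {p | A.sign p e = 0}

/-- A vertex: a point that is a `0`-dimensional face, where the face of a point consists of
all points in the same position with respect to all elements. -/
def IsVertex (A : PseudosphereArrangement E n) (v : USphere n) : Prop :=
  ∀ p, A.sign p = A.sign v → p = v

/-- `A` is an arrangement of the oriented matroid `M`: the covectors of `M` are the zero vector
and the position vectors of the points. -/
def Represents (A : PseudosphereArrangement E n) (M : OrientedMatroid α) : Prop :=
  M.E = E ∧ M.covectors = insert 0 (range A.sign)

end PseudosphereArrangement

/-! ### Underlying matroids of minors -/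

namespace OrientedMatroid

variable {α : Type*}

/-! The combinatorial claims concern only supports, so they are settled in the underlying matroid of
`N`, the extension-lifting. Genericity puts `f` in a circuit and `g` in a cocircuit, so `f` is not a
coloop and `g` is not a loop. Hence the bases of `N \ f` are the bases of `N` avoiding `f`, the
bases of `N / g` are those of `N` through `g` with `g` removed, and the bases of `M` are the bases
of `N / g` avoiding `f` (`isBase_iff`). A cocircuit containing `g` is the complement, in the ground
set of `N`, of a basis `B` of `N / g`. It contains `f` exactly when `f ∉ B`, that is, when `B` is a
basis of `M` (`isCocircuit_iff_exists_isBase`). The claims on fundamental circuits and cocircuits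
follow because one basis inside another equals it, and from the orthogonality of circuits and
cocircuits.

The geometric claims need vertices to correspond to signed cocircuits. On the flat of a cocircuit no
point lies on any element of the support, by minimality. This flat is a sphere with empty equator,
so it is an `S^0`: two opposite points, told apart by a sign (`eq_of_sign_apply_eq`). Conversely, a
vertex is an isolated point of its flat. A nonzero covector of smaller support would give a second
point of that flat on some pseudosphere cutting it. The flat is then neither an `S^0`, as its
equator is nonempty, nor a connected sphere, as it has an isolated point and another one
(`isSignedCocircuit_of_isVertex`). -/

lemma toMatroid_delete (M : OrientedMatroid α) (e : α) :
    (M.delete e).toMatroid = M.toMatroid.delete {e} := by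
  refine Matroid.ext_indep rfl fun I hI => ?_
  have heI : e ∉ I := fun h => (hI h).2 rfl
  rw [Matroid.deleteElem_indep_iff, toMatroid_indep, toMatroid_indep, and_iff_left heI]
  constructor
  · rintro ⟨-, h⟩
    refine ⟨hI.trans sdiff_subset, fun a ha => ?_⟩
    obtain ⟨X, ⟨-, Y, hY, hXY⟩, h1, h2⟩ := h a ha
    have hne : ∀ b ∈ I, b ≠ e := fun b hb h => heI (h ▸ hb)
    exact ⟨Y, hY, by rwa [← hXY a (hne a ha)],
      fun b hb hba => by rw [← hXY b (hne b hb)]; exact h2 b hb hba⟩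
  · rintro ⟨-, h⟩
    refine ⟨hI, fun a ha => ?_⟩
    classical
    obtain ⟨Y, hY, h1, h2⟩ := h a ha
    have hne : ∀ b ∈ I, b ≠ e := fun b hb h => heI (h ▸ hb)
    refine ⟨fun b => if b = e then 0 else Y b, ⟨by simp, Y, hY, fun b hb => by simp [hb]⟩, ?_, ?_⟩
    · simpa [hne a ha] using h1
    · intro b hb hba
      simpa [hne b hb] using h2 b hb hba

/-- The covectors separating the elements of `I` in the contraction already vanish at `e`. What
remains is to separate `e` from `I`. -/
lemma toMatroid_contract (M : OrientedMatroid α) {e : α} (he : M.toMatroid.IsNonloop e) :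
    (M.contract e).toMatroid = M.toMatroid.contract {e} := by
  refine Matroid.ext_indep rfl fun I hI => ?_
  have heI : e ∉ I := fun h => (hI h).2 rfl
  rw [he.contractElem_indep_iff, toMatroid_indep, toMatroid_indep, and_iff_right heI]
  constructor
  · rintro ⟨-, h⟩
    obtain ⟨Y, hY, hYe, -⟩ := he.indep.2 e rfl
    refine ⟨insert_subset he.mem_ground (hI.trans sdiff_subset), ?_⟩
    rintro a (rfl | ha)
    -- Here `a` is the contracted element. A covector nonzero at `a` is cleared on `I` one element
    -- at a time: eliminating `b` against the covector that separates `b` within `I` and vanishes at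
    -- `a` changes neither the value at `a` nor the values on the rest of `I`. The number `n` counts
    -- the elements of `I` still in the support.
    · have hclear : ∀ (n : ℕ) (Y : α → SignType), Y ∈ M.covectors → Y a ≠ 0 →
          (I ∩ Function.support Y).ncard = n →
          ∃ X ∈ M.covectors, X a ≠ 0 ∧ ∀ b ∈ insert a I, b ≠ a → X b = 0 := by
        have hIf : I.Finite := M.ground_finite.subset (hI.trans sdiff_subset)
        intro n
        induction n with
        | zero =>
          intro Y hY hYa hn
          rw [ncard_eq_zero (hIf.subset inter_subset_left)] at hn
          refine ⟨Y, hY, hYa, fun b hb hba => ?_⟩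
          by_contra hYb
          exact notMem_empty b (hn ▸ ⟨hb.resolve_left hba, hYb⟩)
        | succ n ih =>
          intro Y hY hYa hn
          obtain ⟨b, hb, hYb⟩ : (I ∩ Function.support Y).Nonempty := by
            rw [nonempty_iff_ne_empty]; intro h; simp [h] at hn
          obtain ⟨X, ⟨hX, hXa⟩, hXb, hXI⟩ := h b hb
          obtain ⟨Z, hZ, hZb, hZ1, -⟩ := M.elim_aux hY hX hYb hXb
          refine ih Z hZ (by rwa [hZ1 a hXa]) ?_
          have : I ∩ Function.support Z = (I ∩ Function.support Y) \ {b} := by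
            ext c
            simp only [mem_inter_iff, Function.mem_support, mem_sdiff, mem_singleton_iff]
            by_cases hcb : c = b
            · simp [hcb, hZb]
            · refine ⟨fun hc => ⟨⟨hc.1, ?_⟩, hcb⟩, fun hc => ⟨hc.1.1, ?_⟩⟩
              · rw [← hZ1 c (hXI c hc.1 hcb)]; exact hc.2
              · rw [hZ1 c (hXI c hc.1.1 hcb)]; exact hc.1.2
          rw [this]
          have := ncard_sdiff_singleton_add_one (a := b) (s := I ∩ Function.support Y) ⟨hb, hYb⟩
            (hIf.subset inter_subset_left)
          omega
      exact hclear _ Y hY hYe rfl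
    · obtain ⟨X, ⟨hX, hXe⟩, hXa, hXI⟩ := h a ha
      refine ⟨X, hX, hXa, ?_⟩
      rintro b (rfl | hb) hba
      exacts [hXe, hXI b hb hba]
  · rintro ⟨-, h⟩
    refine ⟨hI, fun a ha => ?_⟩
    obtain ⟨X, hX, hXa, hXI⟩ := h a (mem_insert_of_mem _ ha)
    have hea : e ≠ a := fun h => heI (h ▸ ha)
    exact ⟨X, ⟨hX, hXI e (mem_insert _ _) hea⟩, hXa,
      fun b hb hba => hXI b (mem_insert_of_mem _ hb) hba⟩

/-! ### Bases, circuits and cocircuits of a generic extension-lifting -/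

section GenericExtensionLifting

variable {M N : OrientedMatroid α} {f g : α}

namespace IsGenericExtensionLifting

lemma f_mem (h : N.IsGenericExtensionLifting M f g) : f ∈ N.E := by simp [h.ground]

lemma isCircuit_iff (h : N.IsGenericExtensionLifting M f g) (C : Set α) :
    N.toMatroid.IsCircuit C ∧ f ∈ C ↔
      ∃ B, (N.toMatroid.delete {f}).IsBase B ∧ C = insert f B := by
  have := Set.ext_iff.1 h.extension.circuits C
  rw [mem_ofPred_eq, mem_ofPred_eq, N.isCircuit_iff] at this
  rw [this, ← toMatroid_delete]
  rfl

lemma isCocircuit_iff_contract (h : N.IsGenericExtensionLifting M f g) (D : Set α) :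
    N.toMatroid.IsCocircuit D ∧ g ∈ D ↔
      ∃ B, (N.contract g).IsBase B ∧ D = insert g ((N.contract g).E \ B) := by
  have := Set.ext_iff.1 h.lifting.cocircuits D
  rwa [mem_ofPred_eq, mem_ofPred_eq, N.isCocircuit_iff] at this

/-- Any basis of `N / g` yields a cocircuit through `g`, and a cocircuit contains no loop. -/
lemma isNonloop (h : N.IsGenericExtensionLifting M f g) : N.toMatroid.IsNonloop g := by
  obtain ⟨B, hB⟩ := (N.contract g).toMatroid.exists_isBase
  obtain ⟨hD, hg⟩ := (h.isCocircuit_iff_contract _).2 ⟨B, hB, rfl⟩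
  exact Matroid.IsCocircuit.isNonloop_of_mem hD hg

lemma isCocircuit_iff (h : N.IsGenericExtensionLifting M f g) (D : Set α) :
    N.toMatroid.IsCocircuit D ∧ g ∈ D ↔
      ∃ B, (N.toMatroid.contract {g}).IsBase B ∧ D = insert g (insert f M.E \ B) := by
  rw [h.isCocircuit_iff_contract, ← N.toMatroid_contract h.isNonloop]
  have : (N.contract g).E = insert f M.E := by
    ext a
    have := h.ne
    have := h.notMem_right
    simp only [contract, mem_sdiff, mem_singleton_iff, h.ground, mem_union, mem_insert_iff]
    grind
  rw [this]
  rfl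

/-- Dually to `isNonloop`, any basis of `N \ f` yields a circuit through `f`. -/
lemma not_isColoop (h : N.IsGenericExtensionLifting M f g) : ¬ N.toMatroid.IsColoop f := by
  obtain ⟨B, hB⟩ := (N.toMatroid.delete {f}).exists_isBase
  obtain ⟨hC, hf⟩ := (h.isCircuit_iff _).2 ⟨B, hB, rfl⟩
  exact hC.not_isColoop_of_mem hf

lemma delete_isBase_iff (h : N.IsGenericExtensionLifting M f g) (B : Set α) :
    (N.toMatroid.delete {f}).IsBase B ↔ N.toMatroid.IsBase B ∧ f ∉ B := by
  have hco : N.toMatroid.Coindep {f} := by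
    rw [Matroid.coindep_def, Matroid.indep_singleton, ← Matroid.not_isLoop_iff h.f_mem,
      Matroid.dual_isLoop_iff_isColoop]
    exact h.not_isColoop
  rw [hco.delete_isBase_iff, disjoint_singleton_right]

lemma contract_isBase_iff (h : N.IsGenericExtensionLifting M f g) (B : Set α) :
    (N.toMatroid.contract {g}).IsBase B ↔ N.toMatroid.IsBase (insert g B) ∧ g ∉ B := by
  rw [h.isNonloop.indep.contract_isBase_iff, union_singleton, disjoint_singleton_right]

lemma isBase_iff_contract (h : N.IsGenericExtensionLifting M f g) (B : Set α) :
    M.IsBase B ↔ (N.toMatroid.contract {g}).IsBase B ∧ f ∉ B := by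
  have hM : M.toMatroid = (N.toMatroid.contract {g}).delete {f} := by
    rw [← N.toMatroid_contract h.isNonloop, ← toMatroid_delete, h.minor_eq]
  -- Contraction creates no coloops, so `f` may be deleted from `N / g` without lowering the rank.
  have hco : (N.toMatroid.contract {g}).Coindep {f} := by
    rw [Matroid.coindep_contract_iff, disjoint_singleton]
    refine ⟨?_, h.ne⟩
    rw [Matroid.coindep_def, Matroid.indep_singleton, ← Matroid.not_isLoop_iff h.f_mem,
      Matroid.dual_isLoop_iff_isColoop]
    exact h.not_isColoop
  rw [IsBase, hM, hco.delete_isBase_iff, disjoint_singleton_right]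

/-- The bases of `M` are the sets that `g` extends to a basis of the extension-lifting. -/
lemma isBase_iff (h : N.IsGenericExtensionLifting M f g) (B : Set α) :
    M.IsBase B ↔ N.IsBase (insert g B) ∧ g ∉ B ∧ f ∉ B := by
  rw [h.isBase_iff_contract, h.contract_isBase_iff, and_assoc, IsBase]

lemma cocircuit_eq (h : N.IsGenericExtensionLifting M f g) {B : Set α} (hB : M.IsBase B) :
    insert g (insert f M.E \ B) = (M.E \ B) ∪ {f, g} := by
  have := ((h.isBase_iff B).1 hB).2.2
  ext a
  simp only [mem_insert_iff, mem_sdiff, mem_union, mem_singleton_iff]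
  grind

lemma isCocircuit_iff_exists_isBase (h : N.IsGenericExtensionLifting M f g) (D : Set α) :
    N.IsCocircuit D ∧ f ∈ D ∧ g ∈ D ↔ ∃ B, M.IsBase B ∧ D = (M.E \ B) ∪ {f, g} := by
  rw [N.isCocircuit_iff, and_comm (a := f ∈ D), ← and_assoc, h.isCocircuit_iff]
  constructor
  · rintro ⟨⟨B, hB, rfl⟩, hf⟩
    have hfB : f ∉ B := (hf.resolve_left h.ne).2
    have hB' := (h.isBase_iff_contract B).2 ⟨hB, hfB⟩
    exact ⟨B, hB', h.cocircuit_eq hB'⟩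
  · rintro ⟨B, hB, rfl⟩
    exact ⟨⟨B, ((h.isBase_iff_contract B).1 hB).1, (h.cocircuit_eq hB).symm⟩, by simp⟩

lemma isBase_compl_support (h : N.IsGenericExtensionLifting M f g) {X : α → SignType}
    (hX : N.IsSignedCocircuit X) (hf : X f ≠ 0) (hg : X g ≠ 0) :
    M.IsBase {e ∈ N.E | X e = 0} := by
  obtain ⟨B, hB, hXB⟩ := (h.isCocircuit_iff_exists_isBase (Function.support X)).1
    ⟨⟨X, hX, rfl⟩, hf, hg⟩
  obtain ⟨-, hgB, hfB⟩ := (h.isBase_iff B).1 hB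
  have hBE : B ⊆ M.E := Matroid.IsBase.subset_ground hB
  convert hB using 1
  ext a
  have ha := Set.ext_iff.1 hXB a
  simp only [Function.mem_support, mem_union, mem_sdiff, mem_insert_iff, mem_singleton_iff] at ha
  simp only [mem_ofPred_eq, h.ground, mem_union, mem_insert_iff, mem_singleton_iff]
  have := @hBE a
  have := h.notMem_left
  have := h.notMem_right
  grind

lemma bijOn_cocircuits (h : N.IsGenericExtensionLifting M f g) :
    Set.BijOn (fun B => (M.E \ B) ∪ {f, g}) {B | M.IsBase B}
      {D | N.IsCocircuit D ∧ f ∈ D ∧ g ∈ D} := by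
  refine ⟨fun B hB => (h.isCocircuit_iff_exists_isBase _).2 ⟨B, hB, rfl⟩, ?_, ?_⟩
  · intro B (hB : M.IsBase B) B' (hB' : M.IsBase B') heq
    have hBE : B ⊆ M.E := Matroid.IsBase.subset_ground hB
    have hBE' : B' ⊆ M.E := Matroid.IsBase.subset_ground hB'
    ext a
    have ha := Set.ext_iff.1 heq a
    simp only [mem_union, mem_sdiff, mem_insert_iff, mem_singleton_iff] at ha
    have := @hBE a
    have := @hBE' a
    have := h.notMem_left
    have := h.notMem_right
    grind
  · intro D hD
    obtain ⟨B, hB, rfl⟩ := (h.isCocircuit_iff_exists_isBase D).1 hD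
    exact ⟨B, hB, rfl⟩

lemma bijOn_bases (h : N.IsGenericExtensionLifting M f g) :
    Set.BijOn (fun B => insert g B) {B | M.IsBase B}
      {B' | N.IsBase B' ∧ g ∈ B' ∧ f ∉ B'} := by
  refine ⟨fun B hB => ?_, fun B hB B' hB' heq => ?_, ?_⟩
  · obtain ⟨hB, hg, hf⟩ := (h.isBase_iff B).1 hB
    exact ⟨hB, mem_insert _ _, by simp [h.ne, hf]⟩
  · have hg := ((h.isBase_iff B).1 hB).2.1
    have hg' := ((h.isBase_iff B').1 hB').2.1
    have heq : insert g B = insert g B' := heq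
    rw [← insert_sdiff_self_of_notMem hg, heq, insert_sdiff_self_of_notMem hg']
  · rintro B ⟨hB, hg, hf⟩
    refine ⟨B \ {g}, (h.isBase_iff _).2 ⟨?_, by simp, fun hf' => hf hf'.1⟩, ?_⟩
    · rwa [insert_sdiff_singleton, insert_eq_of_mem hg]
    · simp [insert_eq_of_mem hg]

/-- The cocircuit contains `g`, so genericity makes it the complement of a basis `B'` of `N / g`. It
misses `B`, whence `B ⊆ B'`, and two nested bases of `N / g` coincide. -/
lemma support_fundCocircuit (h : N.IsGenericExtensionLifting M f g) {B : Set α}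
    (hB : M.IsBase B) {D : α → SignType} (hD : N.IsFundCocircuit (insert g B) g D) :
    Function.support D = (M.E \ B) ∪ {f, g} := by
  obtain ⟨hNB, hgB, hfB⟩ := (h.isBase_iff B).1 hB
  have hNB' : N.toMatroid.IsBase (insert g B) := hNB
  obtain ⟨hD, hs, hg⟩ := hD
  obtain ⟨B', hB', hDB'⟩ := (h.isCocircuit_iff (Function.support D)).1
    ⟨(N.isCocircuit_iff _).1 ⟨D, hD, rfl⟩, by simp [hg]⟩
  have hBB' : B ⊆ B' := by
    intro a ha
    have hBE : B ⊆ M.E := Matroid.IsBase.subset_ground hB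
    have haD : a ∉ Function.support D := by
      rw [hs, insert_sdiff_self_of_notMem hgB]
      exact fun hc => hc.2 (N.toMatroid.mem_closure_of_mem' ha (by
        rw [toMatroid_E, h.ground]; exact Or.inl (hBE ha)))
    by_contra haB'
    exact haD (by rw [hDB']; exact Or.inr ⟨Or.inr (hBE ha), haB'⟩)
  have hBeq := ((h.isBase_iff_contract B).1 hB).1.eq_of_subset_isBase hB' hBB'
  rw [hDB', ← hBeq, h.cocircuit_eq hB]

/-- Otherwise `f` lies in the closure of `B \ {b}` and closes a circuit with part of it. By
genericity that part is a basis, yet it is properly contained in the basis `B`. -/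
lemma mem_support_fundCocircuit (h : N.IsGenericExtensionLifting M f g) {B : Set α}
    (hB : N.IsBase B) (hfB : f ∉ B) {b : α} (hb : b ∈ B) {D : α → SignType}
    (hD : N.IsFundCocircuit B b D) : f ∈ Function.support D := by
  have hB' : N.toMatroid.IsBase B := hB
  rw [hD.2.1]
  refine ⟨h.f_mem, fun hcl => ?_⟩
  have hI := hB'.indep.subset (sdiff_subset (s := B) (t := {b}))
  have hC := hI.fundCircuit_isCircuit hcl fun hf => hfB hf.1
  obtain ⟨B', hB'', hCB⟩ := (h.isCircuit_iff _).1 ⟨hC, N.toMatroid.mem_fundCircuit _ _⟩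
  obtain ⟨hB1, hfB'⟩ := (h.delete_isBase_iff _).1 hB''
  have hsub : B' ⊆ B \ {b} := fun a ha => by
    have : a ∈ insert f (B \ {b}) :=
      N.toMatroid.fundCircuit_subset_insert _ _ (hCB ▸ mem_insert_of_mem _ ha)
    exact this.resolve_left fun h => hfB' (h ▸ ha)
  have heq := hB1.eq_of_subset_isBase hB' (hsub.trans sdiff_subset)
  exact (hsub (heq ▸ hb)).2 rfl

/-- The cocircuit `C*(B ∪ g; g)` contains `e` and can meet this circuit only in `e` and `g`.
Orthogonality forbids that they meet in `e` alone. -/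
lemma mem_support_fundCircuit (h : N.IsGenericExtensionLifting M f g) {B : Set α}
    (hB : M.IsBase B) {e : α} (he : e ∈ M.E \ B) {C : α → SignType}
    (hC : N.IsFundCircuit (insert g B) e C) : g ∈ Function.support C := by
  obtain ⟨hNB, hgB, hfB⟩ := (h.isBase_iff B).1 hB
  obtain ⟨D, hD, -⟩ := N.existsUnique_fundCocircuit hNB (mem_insert g B)
  have hDs := h.support_fundCocircuit hB hD
  have hDe : D e ≠ 0 := by
    have : e ∈ Function.support D := by rw [hDs]; exact Or.inl he
    exact this
  have hort := orthogonal_aux (hC.1.1.2 D hD.1.1) (b := g) (e := e) fun a hag hae => by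
    by_cases hCa : C a = 0
    · rw [hCa, zero_mul]
    · have haB : a ∈ B := ((hC.2.1 hCa).resolve_left hae).resolve_left hag
      have : a ∉ Function.support D := by
        have : a ∈ M.E := Matroid.IsBase.subset_ground hB haB
        rw [hDs]
        rintro (ha | rfl | rfl)
        exacts [ha.2 haB, hfB haB, hgB haB]
      rw [Function.notMem_support.1 this, mul_zero]
  intro hCg
  rw [hCg, zero_mul, hC.2.2, one_mul] at hort
  exact hDe ((neg_eq_zero_iff _).1 hort.symm)

/-- Genericity makes the circuit `f` together with a basis; that basis lies inside `B`, hence is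
`B`. -/
lemma support_fundCircuit (h : N.IsGenericExtensionLifting M f g) {B : Set α}
    (hB : N.IsBase B) {C : α → SignType} (hC : N.IsFundCircuit B f C) :
    Function.support C = insert f B := by
  obtain ⟨B', hB', hCB⟩ := (h.isCircuit_iff (Function.support C)).1
    ⟨(N.isCircuit_iff _).1 ⟨C, hC.1, rfl⟩, by simp [hC.2.2]⟩
  obtain ⟨hB1, hfB'⟩ := (h.delete_isBase_iff _).1 hB'
  have hsub : B' ⊆ B := fun a ha =>
    (hC.2.1 (hCB ▸ mem_insert_of_mem _ ha)).resolve_left fun h => hfB' (h ▸ ha)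
  rw [hCB, hB1.eq_of_subset_isBase hB hsub]

end IsGenericExtensionLifting

end GenericExtensionLifting

end OrientedMatroid

/-! ### Equators, hemispheres and connectedness of standard spheres -/

lemma USphere.last_ne_zero (x : USphere 1) : x.1 (Fin.last 0) ≠ 0 := by
  intro h
  have hx : ‖x.1‖ = 1 := by simp
  have : x.1 = 0 := by
    ext i
    rw [Subsingleton.elim i (Fin.last 0), h]
    rfl
  rw [this, norm_zero] at hx
  exact zero_ne_one hx

lemma USphere.eq_of_sign_eq {x y : USphere 1}
    (h : SignType.sign (x.1 (Fin.last 0)) = SignType.sign (y.1 (Fin.last 0))) : x = y := by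
  -- The only coordinate has absolute value `1`, so it equals its own sign.
  have key : ∀ z : USphere 1, z.1 (Fin.last 0) = SignType.sign (z.1 (Fin.last 0)) := fun z => by
    have hz : ‖z.1‖ = 1 := by simp
    rw [EuclideanSpace.norm_eq, Real.sqrt_eq_one] at hz
    have hz : ‖z.1 (Fin.last 0)‖ ^ 2 = 1 := by simpa using hz
    rw [Real.norm_eq_abs, pow_eq_one_iff_of_nonneg (abs_nonneg _) two_ne_zero] at hz
    have hs := sign_mul_abs (z.1 (Fin.last 0))
    rw [hz, mul_one] at hs
    exact hs.symm
  ext i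
  rw [Subsingleton.elim i (Fin.last 0), key x, key y, h]

lemma USphere.exists_last_eq_zero (k : ℕ) : ∃ x : USphere (k + 2), x.1 (Fin.last (k + 1)) = 0 :=
  ⟨⟨EuclideanSpace.single 0 1, by simp⟩, by simp [Fin.ext_iff]⟩

lemma USphere.preconnectedSpace (k : ℕ) : PreconnectedSpace (USphere (k + 2)) := by
  refine isPreconnected_iff_preconnectedSpace.1 (isPreconnected_sphere ?_ _ _)
  rw [rank_eq_card_basis (EuclideanSpace.basisFun (Fin (k + 2)) ℝ).toBasis]
  simp only [Fintype.card_fin]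
  exact_mod_cast (by omega : 1 < k + 2)

lemma USphere.isOpen_sign_eq (k : ℕ) {s : SignType} (hs : s ≠ 0) :
    IsOpen {x : USphere (k + 1) | SignType.sign (x.1 (Fin.last k)) = s} := by
  have hc : Continuous fun x : USphere (k + 1) => x.1 (Fin.last k) := by fun_prop
  rcases SignType.trichotomy s with rfl | rfl | rfl
  · simp only [sign_eq_neg_one_iff]
    exact isOpen_lt hc continuous_const
  · exact absurd rfl hs
  · simp only [sign_eq_one_iff]
    exact isOpen_lt continuous_const hc

/-! ### Vertices of an arrangement and signed cocircuits -/

namespace PseudosphereArrangement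

variable {α : Type*} {n : ℕ} {M : OrientedMatroid α} {A : PseudosphereArrangement M.E n}

lemma Represents.sign_mem (hA : A.Represents M) (p : USphere n) : A.sign p ∈ M.covectors := by
  rw [hA.2]; exact Or.inr ⟨p, rfl⟩

lemma sign_ne_zero (p : USphere n) : A.sign p ≠ 0 := by
  obtain ⟨e, -, he⟩ := A.essential p
  exact fun h => he (congrFun h e)

lemma Represents.exists_sign_eq (hA : A.Represents M) {X : α → SignType} (hX : X ∈ M.covectors)
    (hX0 : X ≠ 0) : ∃ p, A.sign p = X := by
  rw [hA.2] at hX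
  exact hX.resolve_left hX0

/-- On the flat of a cocircuit, points are determined by the side of any element of the support. -/
lemma Represents.eq_of_sign_apply_eq (hA : A.Represents M) {X : α → SignType}
    (hX : M.IsSignedCocircuit X) {e : α} (he : X e ≠ 0) {p q : USphere n}
    (hp : ∀ a ∈ M.E, X a = 0 → A.sign p a = 0) (hq : ∀ a ∈ M.E, X a = 0 → A.sign q a = 0)
    (hpq : A.sign p e = A.sign q e) : p = q := by
  -- The position vector of a point of the flat is a nonzero covector supported in the support of
  -- `X`, so by minimality it has the same support.
  have hne : ∀ p : USphere n, (∀ a ∈ M.E, X a = 0 → A.sign p a = 0) → A.sign p e ≠ 0 := by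
    intro p hp
    have := hX.2.2 _ (hA.sign_mem p) (sign_ne_zero p) fun a ha hXa =>
      ha (hp a (M.support_subset _ (hA.sign_mem p) ha) hXa)
    exact this.symm.subset he
  obtain ⟨k, φ, hφ⟩ := A.inter_pseudosphere {a ∈ M.E | X a = 0} (fun a ha => ha.1) e
    (M.support_subset X hX.1 he) ⟨p, fun a ha => hp a ha.1 ha.2, hne p hp⟩
  have hφne : ∀ x, A.sign (φ x).1 e ≠ 0 := fun x => hne _ fun a ha hXa => (φ x).2 a ⟨ha, hXa⟩
  -- `USphere (k + 1)` is the sphere `S^k`. For `k = 0` the sign determines the point; for larger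
  -- `k` the equator is nonempty, although `S_e` misses the flat.
  obtain _ | k := k
  · let p' : {p | ∀ a ∈ {a ∈ M.E | X a = 0}, A.sign p a = 0} := ⟨p, fun a ha => hp a ha.1 ha.2⟩
    let q' : {p | ∀ a ∈ {a ∈ M.E | X a = 0}, A.sign p a = 0} := ⟨q, fun a ha => hq a ha.1 ha.2⟩
    have : φ.symm p' = φ.symm q' := by
      apply USphere.eq_of_sign_eq
      rw [← hφ, ← hφ, φ.apply_symm_apply, φ.apply_symm_apply]
      exact hpq
    exact congrArg Subtype.val (φ.symm.injective this)
  · obtain ⟨x, hx⟩ := USphere.exists_last_eq_zero k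
    exact absurd (by rw [hφ, hx, sign_zero]) (hφne x)

lemma Represents.isVertex_of_isSignedCocircuit (hA : A.Represents M) {v : USphere n}
    (hv : M.IsSignedCocircuit (A.sign v)) : A.IsVertex v := by
  intro p hp
  obtain ⟨e, -, he⟩ := A.essential v
  exact hA.eq_of_sign_apply_eq hv he (fun a _ h => by rwa [hp]) (fun a _ h => h) (by rw [hp])

/-- The flat of a cocircuit consists of a vertex and the opposite vertex. -/
lemma Represents.exists_opposite (hA : A.Represents M) {v : USphere n}
    (hv : M.IsSignedCocircuit (A.sign v)) :
    ∃ w, w ≠ v ∧ A.sign w = -A.sign v ∧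
      ⋂ e ∈ {e ∈ M.E | A.sign v e = 0}, A.pseudosphere e = {v, w} := by
  obtain ⟨e, -, he⟩ := A.essential v
  have hneg : -A.sign v ≠ 0 := fun h => sign_ne_zero v (by
    funext a
    exact (OrientedMatroid.neg_eq_zero_iff _).1 (congrFun h a))
  obtain ⟨w, hw⟩ := hA.exists_sign_eq (M.neg_mem _ hv.1) hneg
  have hw0 : ∀ a ∈ M.E, A.sign v a = 0 → A.sign w a = 0 := fun a _ h => by simp [hw, h]
  refine ⟨w, ?_, hw, ?_⟩
  · rintro rfl
    have := congrFun hw e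
    rw [Pi.neg_apply] at this
    revert this he
    generalize A.sign w e = s
    revert s; decide
  · ext p
    simp only [mem_iInter, mem_ofPred_eq, pseudosphere, mem_insert_iff, mem_singleton_iff]
    constructor
    · intro hp
      have hp' : ∀ a ∈ M.E, A.sign v a = 0 → A.sign p a = 0 := fun a h1 h2 => hp a ⟨h1, h2⟩
      have hpe : A.sign p e ≠ 0 := by
        have := hv.2.2 _ (hA.sign_mem p) (sign_ne_zero p) fun a ha hXa =>
          ha (hp' a (M.support_subset _ (hA.sign_mem p) ha) hXa)
        exact this.symm.subset he
      rcases OrientedMatroid.eq_or_eq_neg hpe he with h | h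
      · exact Or.inl (hA.eq_of_sign_apply_eq hv he hp' (fun a _ h => h) h)
      · exact Or.inr (hA.eq_of_sign_apply_eq hv he hp' hw0 (by rw [h, hw]; rfl))
    · rintro (rfl | rfl) a ⟨ha, h⟩
      exacts [h, hw0 a ha h]

/-- If minimality failed, the flat `S` of `v` would contain a point `p` on some `S_e` that avoids
`v`, while `v` is isolated in `S`. No sphere allows both. -/
lemma Represents.isSignedCocircuit_of_isVertex (hA : A.Represents M) {v : USphere n}
    (hv : A.IsVertex v) : M.IsSignedCocircuit (A.sign v) := by
  refine ⟨hA.sign_mem v, sign_ne_zero v, fun Y hY hY0 hYv => ?_⟩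
  by_contra hne
  obtain ⟨e, he, heY⟩ : ∃ e, A.sign v e ≠ 0 ∧ Y e = 0 := by
    by_contra! h
    exact hne (hYv.antisymm fun e he => h e he)
  obtain ⟨p, rfl⟩ := hA.exists_sign_eq hY hY0
  let S : Set (USphere n) := {p | ∀ a ∈ {a ∈ M.E | A.sign v a = 0}, A.sign p a = 0}
  let v' : S := ⟨v, fun a ha => ha.2⟩
  let p' : S := ⟨p, fun a ha => by
    by_contra h
    exact hYv h ha.2⟩
  have hcut := fun a (ha : A.sign v a ≠ 0) => A.inter_pseudosphere {a ∈ M.E | A.sign v a = 0}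
    (fun a ha => ha.1) a (M.support_subset _ (hA.sign_mem v) ha) ⟨v, v'.2, ha⟩
  have hopen : IsOpen ({v'} : Set S) := by
    have hfin : {a | A.sign v a ≠ 0}.Finite :=
      M.ground_finite.subset (M.support_subset _ (hA.sign_mem v))
    -- Within its flat, a vertex is cut out by its strict sides alone: finitely many sets, each an
    -- open hemisphere up to homeomorphism.
    have heq : ({v'} : Set S) =
        ⋂ a ∈ {a | A.sign v a ≠ 0}, {q : S | A.sign q.1 a = A.sign v a} := by
      ext q
      simp only [mem_singleton_iff, mem_iInter, mem_ofPred_eq]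
      refine ⟨fun h a _ => by rw [h], fun h => Subtype.ext (hv _ (funext fun a => ?_))⟩
      by_cases ha : A.sign v a = 0
      · rw [ha]
        by_cases haE : a ∈ M.E
        · exact q.2 a ⟨haE, ha⟩
        · by_contra hq
          exact haE (M.support_subset _ (hA.sign_mem q.1) hq)
      · exact h a ha
    rw [heq]
    refine hfin.isOpen_biInter fun a ha => ?_
    obtain ⟨k, φ, hφ⟩ := hcut a ha
    convert (USphere.isOpen_sign_eq k ha).preimage φ.symm.continuous using 1
    ext q
    rw [mem_preimage, mem_ofPred_eq, mem_ofPred_eq, ← hφ, φ.apply_symm_apply]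
  obtain ⟨k, φ, hφ⟩ := hcut e he
  -- In `S^0` the equator is empty, but it should contain `p'`. A higher sphere is connected, so the
  -- clopen set `{v'}` is all of `S`, forcing `p' = v'`.
  obtain _ | k := k
  · refine USphere.last_ne_zero (φ.symm p') (sign_eq_zero_iff.1 ?_)
    rw [← hφ, φ.apply_symm_apply]
    exact heY
  · have := USphere.preconnectedSpace k
    have : PreconnectedSpace S := φ.surjective.denseRange.preconnectedSpace φ.continuous
    have huniv := (show IsClopen ({v'} : Set S) from ⟨isClosed_singleton, hopen⟩).eq_univ ⟨v', rfl⟩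
    have hpv : p' = v' := huniv.symm.subset (mem_univ p')
    exact he ((congrArg (fun q : S => A.sign q.1 e) hpv).symm.trans heY)

end PseudosphereArrangement

/-! ### The main statement -/

theorem proposition1 {α : Type*} (M Mbar : OrientedMatroid α) (f g : α) (r : ℕ)
    (hr : M.rank = r) (h : Mbar.IsGenericExtensionLifting M f g) :
    -- (i) vertices on neither `f` nor `g`, in an arrangement, and as signed cocircuits
    (∀ (n : ℕ) (A : PseudosphereArrangement Mbar.E n), A.Represents Mbar →
      ∀ v, A.IsVertex v → v ∉ A.pseudosphere f → v ∉ A.pseudosphere g →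
        ∃ B : Set α, M.IsBase B ∧ B.encard = r ∧ {e ∈ Mbar.E | v ∈ A.pseudosphere e} = B ∧
          ∃ w, w ≠ v ∧ A.sign w = -A.sign v ∧ ⋂ e ∈ B, A.pseudosphere e = {v, w}) ∧
    (∀ X, Mbar.IsSignedCocircuit X → X f ≠ 0 → X g ≠ 0 →
      {e ∈ Mbar.E | X e = 0}.encard = r ∧ M.IsBase {e ∈ Mbar.E | X e = 0}) ∧
    -- (ii) the bijection to cocircuits, and their correspondence with the vertices of (i)
    Set.BijOn (fun B => (M.E \ B) ∪ {f, g}) {B | M.IsBase B}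
      {D | Mbar.IsCocircuit D ∧ f ∈ D ∧ g ∈ D} ∧
    (∀ (n : ℕ) (A : PseudosphereArrangement Mbar.E n), A.Represents Mbar →
      Set.BijOn A.sign {v | A.IsVertex v ∧ v ∉ A.pseudosphere f ∧ v ∉ A.pseudosphere g}
        {X | Mbar.IsSignedCocircuit X ∧ X f ≠ 0 ∧ X g ≠ 0}) ∧
    -- (iii) the bijection to bases, and the fundamental cocircuits for `g`
    Set.BijOn (fun B => insert g B) {B | M.IsBase B}
      {B' | Mbar.IsBase B' ∧ g ∈ B' ∧ f ∉ B'} ∧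
    (∀ B, M.IsBase B → ∀ D, Mbar.IsFundCocircuit (insert g B) g D →
      Function.support D = (M.E \ B) ∪ {f, g}) ∧
    -- (iv) fundamental cocircuits and circuits of the basis `B ∪ g`
    (∀ B, g ∉ B → f ∉ B → Mbar.IsBase (insert g B) →
      (∀ b ∈ B, ∀ D, Mbar.IsFundCocircuit (insert g B) b D → f ∈ Function.support D) ∧
      (∀ e ∈ M.E \ B, ∀ C, Mbar.IsFundCircuit (insert g B) e C → g ∈ Function.support C) ∧
      (∀ C, Mbar.IsFundCircuit (insert g B) f C → Function.support C = B ∪ {f, g})) := by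
  have hbase : ∀ X, Mbar.IsSignedCocircuit X → X f ≠ 0 → X g ≠ 0 →
      {e ∈ Mbar.E | X e = 0}.encard = r ∧ M.IsBase {e ∈ Mbar.E | X e = 0} := by
    intro X hX hf hg
    have hB := h.isBase_compl_support hX hf hg
    exact ⟨(Matroid.IsBase.encard_eq_eRank hB).trans hr, hB⟩
  refine ⟨fun n A hA v hv hf hg => ?_, hbase, h.bijOn_cocircuits, fun n A hA => ⟨?_, ?_, ?_⟩,
    h.bijOn_bases, fun B hB D hD => h.support_fundCocircuit hB hD, fun B hg hf hB => ⟨?_, ?_, ?_⟩⟩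
  · have hX := hA.isSignedCocircuit_of_isVertex hv
    obtain ⟨hr, hB⟩ := hbase _ hX hf hg
    exact ⟨_, hB, hr, rfl, hA.exists_opposite hX⟩
  · rintro v ⟨hv, hf, hg⟩
    exact ⟨hA.isSignedCocircuit_of_isVertex hv, hf, hg⟩
  -- Injectivity is the definition of a vertex: no other point has its position vector.
  · rintro v - w ⟨hw, -⟩ hvw
    exact hw v hvw
  · rintro X ⟨hX, hf, hg⟩
    obtain ⟨v, rfl⟩ := hA.exists_sign_eq hX.1 hX.2.1
    exact ⟨v, ⟨hA.isVertex_of_isSignedCocircuit hX, hf, hg⟩, rfl⟩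
  · intro b hb D hD
    exact h.mem_support_fundCocircuit hB (by simp [h.ne, hf]) (mem_insert_of_mem _ hb) hD
  · intro e he C hC
    exact h.mem_support_fundCircuit ((h.isBase_iff B).2 ⟨hB, hg, hf⟩) he hC
  · intro C hC
    rw [h.support_fundCircuit hB hC]
    ext a
    simp only [mem_insert_iff, mem_union, mem_singleton_iff]
    tauto
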